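/- **Lemma (Alternate upper bound for shifted exponential).** Consider $K$-async SGD with a parameter server and $P$ workers: at time $0$ all workers start computing a gradient on a mini-batch; in each iteration the server waits until $K$ of the workers have finished their current mini-batch and then updates the parameter; at that moment these $K$ workers (idle since they finished) start a new mini-batch, while the remaining $P-K$ workers are not cancelled and continue (ties are broken by the index of the worker). Let $T_j$ $(j\ge 1)$ denote the runtime of the $j$-th iteration, i.e. the time between the $(j-1)$-th and the $j$-th update (the $0$-th update being time $0$). Suppose that $P=nK$ with integers $n>1$ and $K\ge 1$, and that the times that the workers take for their mini-batches are i.i.d. across workers and mini-batches with the shifted exponential distribution $\Delta+\mathrm{Exp}(\mu)$, where $\Delta\ge 0$ and $\mu>0$ is the rate. Then all expectations below are finite, and the expected runtime of any $n$ consecutive iterations satisfies, for every $j\ge 0$, $$\mathbb E[T_{j+1}+T_{j+2}+\dots+T_{j+n}]\le \Delta+\sum_{i=0}^{n-1}\mathbb E\big[\widetilde X_{K:(P-iK)}\big],$$ where $\widetilde X_{K:m}$ denotes the $K$-th smallest of $m$ i.i.d. $\mathrm{Exp}(\mu)$ random variables. Moreover, the resulting bound per iteration is $\frac{K\Delta}{P}+\frac{K\log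 P}{P\mu}$ up to an error of at most $\frac{K}{P\mu}$: $$\left|\frac1n\Big(\Delta+\sum_{i=0}^{n-1}\mathbb E\big[\widetilde X_{K:(P-iK)}\big]\Big)-\Big(\frac{K\Delta}{P}+\frac{K\log P}{P\mu}\Big)\right|\le\frac{K}{P\mu},$$ and hence, for every $j\ge 0$, $$\frac1n\,\mathbb E[T_{j+1}+\dots+T_{j+n}]\le\frac{K\Delta}{P}+\frac{K(\log P+1)}{P\mu}.$$ -/

import Mathlib

open MeasureTheory ProbabilityTheory

/-- The `k`-th order statistic `x_{k:m}`: the `k`-th smallest (`k = 1, …, m`) of the `m` numbers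
`x 0, …, x (m - 1)`, counted with multiplicity. Only `1 ≤ k ≤ m` is meaningful (`0` otherwise). -/
noncomputable def orderStat {m : ℕ} (k : ℕ) (x : Fin m → ℝ) : ℝ :=
  if h : 1 ≤ k ∧ k ≤ m then x (Tuple.sort x ⟨k - 1, by omega⟩) else 0

/-- `E[X_{k:m}]` for `m` i.i.d. random variables with law `ν`. -/
noncomputable def meanOrderStat (ν : Measure ℝ) (k m : ℕ) : ℝ :=
  ∫ x : Fin m → ℝ, orderStat k x ∂(Measure.pi fun _ => ν)

/-- The shifted exponential law `Δ + Exp(μ)`. -/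
noncomputable def shiftedExp (Δ μ : ℝ) : Measure ℝ :=
  (expMeasure μ).map (fun x => Δ + x)

namespace KAsync

/-- The state of the system of `P` workers right after an update of the parameter server. -/
structure State (P : ℕ) where
  /-- the time of the last update of the parameter server (`0` before the first update) -/
  time : ℝ
  /-- the time at which each worker started the mini-batch it is working on -/
  start : Fin P → ℝ
  /-- the number of mini-batches which each worker has already contributed; hence also the
  (zero-based) index of the mini-batch it is working on -/
  count : Fin P → ℕ

/-- At time `0` all workers start with their first mini-batch. -/
def initial (P : ℕ) : State P where
  time := 0
  start := fun _ => 0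
  count := fun _ => 0

/-- The times at which the workers finish their current mini-batches, where `X i k` is the time
that worker `i` needs for its `k`-th mini-batch. -/
def State.finish {P : ℕ} (X : Fin P → ℕ → ℝ) (s : State P) (i : Fin P) : ℝ :=
  s.start i + X i (s.count i)

/-- Worker `i` is one of the `K` workers that finish first. Here `(Tuple.sort f).symm i` is the
zero-based rank of `f i` among the values of `f`, equal values being ranked by their index. -/
def State.IsFirst {P : ℕ} (K : ℕ) (X : Fin P → ℕ → ℝ) (s : State P) (i : Fin P) : Prop :=
  ((Tuple.sort (s.finish X)).symm i : ℕ) < K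

open Classical in
/-- One iteration of `K`-async SGD. The parameter server waits until `K` workers have finished and
then updates. At this moment the `K` workers that finished first (idle until then) read the new
parameter and start a new mini-batch; the others are not cancelled and continue. -/
noncomputable def step {P : ℕ} (K : ℕ) (X : Fin P → ℕ → ℝ) (s : State P) : State P where
  time := orderStat K (s.finish X)
  start := fun i => if s.IsFirst K X i then orderStat K (s.finish X) else s.start i
  count := fun i => if s.IsFirst K X i then s.count i + 1 else s.count i

/-- The state after `j` iterations. -/
noncomputable def state {P : ℕ} (K : ℕ) (X : Fin P → ℕ → ℝ) : ℕ → State P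
  | 0 => initial P
  | j + 1 => step K X (state K X j)

/-- The runtime of iteration `j` (zero-based): the time between two consecutive updates. -/
noncomputable def runtime {P : ℕ} (K : ℕ) (X : Fin P → ℕ → ℝ) (j : ℕ) : ℝ :=
  (state K X (j + 1)).time - (state K X j).time

end KAsync

/-! Fix an update `j` and let `M` be the time at which every worker has finished the mini-batch then
in progress. By pigeonhole `n` further updates are over by time `M` (`KAsync.time_add_le`): a worker
still busy after `M` has contributed since update `j`, and `n - 1` updates account for only `(n - 1)
* K` of the `n * K` workers. So the `n` runtimes add up to at most the largest residual time of the
`P` current mini-batches.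

The residual times are compared with fresh ones. Split according to the vector `c` of contribution
counts and freeze the completed mini-batches. The current times then affect the state only through
being longer than the workers' ages (`KAsync.lintegral_section_le`), so they are independent and
conditioned to exceed those ages. The law `Δ + Exp(μ)` is new better than used
(`shiftedExp_Ici_mul_Iic_le`), hence the largest residual has mean at most that of the maximum of
`P` fresh times (`lintegral_max_residual_le`, `KAsync.lintegral_maxResidual_le`).

That maximum has mean `Δ + H_P / μ`, with `H_P` the harmonic number. Since `E[X_{k:m}] = ∑_{r<k} 1 /
(μ (m - r))`, the means in the claimed bound are consecutive blocks of the harmonic sum and add up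
to the same `H_P / μ` (`sum_meanOrderStat_expMeasure`). The logarithmic form follows from `|H_P -
log P| ≤ 1`. -/

/-! ### Order statistics and ranks -/

theorem orderStat_eq {m k : ℕ} (hk : 1 ≤ k) (hm : k ≤ m) (x : Fin m → ℝ) :
    orderStat k x = x (Tuple.sort x ⟨k - 1, by omega⟩) := by
  rw [orderStat, dif_pos ⟨hk, hm⟩]

/-- Turns order statistics into counting; measurability, the pigeonhole step and the tail formula
all rest on it. -/
theorem orderStat_le_iff {m k : ℕ} (hk : 1 ≤ k) (hm : k ≤ m) (x : Fin m → ℝ) (s : ℝ) :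
    orderStat k x ≤ s ↔ k ≤ (Finset.univ.filter fun i => x i ≤ s).card := by
  rw [orderStat_eq hk hm]
  have h := Tuple.lt_card_le_iff_apply_le_of_monotone (j := ⟨k - 1, by omega⟩) (a := s)
    (Tuple.monotone_sort x)
  have hc : (Finset.univ.filter fun i => (x ∘ Tuple.sort x) i ≤ s).card
      = (Finset.univ.filter fun i => x i ≤ s).card :=
    Finset.card_equiv (Tuple.sort x) (by simp)
  rw [hc] at h
  simp only [Function.comp] at h
  rw [← h]
  omega

theorem orderStat_self_le_iff {m : ℕ} (hm : 1 ≤ m) (x : Fin m → ℝ) (s : ℝ) :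
    orderStat m x ≤ s ↔ ∀ i, x i ≤ s := by
  rw [orderStat_le_iff hm le_rfl]
  constructor
  · intro h i
    have : (Finset.univ.filter fun i => x i ≤ s) = Finset.univ :=
      Finset.eq_univ_of_card _ (le_antisymm (Finset.card_le_univ _) (by simpa using h))
    have hi := Finset.mem_univ i
    rw [← this] at hi
    simpa using hi
  · intro h
    simp [h]

/-- `Tuple.sort` is stable, so ranks follow the lexicographic order of value and index. -/
theorem Tuple.sort_symm_lt_iff {m : ℕ} (f : Fin m → ℝ) (i i' : Fin m) :
    (Tuple.sort f).symm i < (Tuple.sort f).symm i' ↔ f i < f i' ∨ f i = f i' ∧ i < i' := by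
  obtain ⟨h1, h2⟩ := (Tuple.eq_sort_iff (f := f) (σ := Tuple.sort f)).1 rfl
  have key : ∀ a b, (Tuple.sort f).symm a < (Tuple.sort f).symm b →
      f a < f b ∨ f a = f b ∧ a < b := by
    intro a b hab
    have hle : f a ≤ f b := by simpa using h1 hab.le
    rcases hle.lt_or_eq with h | h
    · exact Or.inl h
    · exact Or.inr ⟨h, by simpa using h2 _ _ hab (by simpa using h)⟩
  refine ⟨key i i', fun h => ?_⟩
  by_contra hc
  rcases (not_lt.1 hc).lt_or_eq with h' | h'
  · rcases key _ _ h' with h3 | h3 <;> rcases h with h4 | h4 <;> grind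
  · have : i' = i := (Tuple.sort f).symm.injective h'
    subst this
    simp at h

theorem Tuple.sort_symm_eq_card {m : ℕ} (f : Fin m → ℝ) (i : Fin m) :
    ((Tuple.sort f).symm i : ℕ) =
      (Finset.univ.filter fun i' => f i' < f i ∨ f i' = f i ∧ i' < i).card := by
  simp_rw [← Tuple.sort_symm_lt_iff]
  rw [Finset.card_equiv (t := Finset.Iio ((Tuple.sort f).symm i)) (Tuple.sort f).symm (by simp),
    Fin.card_Iio]

theorem card_sort_symm_lt {m k : ℕ} (hm : k ≤ m) (f : Fin m → ℝ) :
    (Finset.univ.filter fun i => ((Tuple.sort f).symm i : ℕ) < k).card = k := by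
  rw [Finset.card_equiv (t := Finset.univ.filter fun i : Fin m => (i : ℕ) < k)
    (Tuple.sort f).symm (by simp), Fin.card_filter_val_lt]
  omega

theorem le_orderStat_of_sort_symm_lt {m k : ℕ} (hk : 1 ≤ k) (hm : k ≤ m) (f : Fin m → ℝ)
    (i : Fin m) (h : ((Tuple.sort f).symm i : ℕ) < k) : f i ≤ orderStat k f := by
  rw [orderStat_eq hk hm]
  have := Tuple.monotone_sort f (a := (Tuple.sort f).symm i) (b := ⟨k - 1, by omega⟩)
    (by rw [Fin.le_def]; simp only; omega)
  simpa using this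

theorem orderStat_le_of_le_sort_symm {m k : ℕ} (hk : 1 ≤ k) (hm : k ≤ m) (f : Fin m → ℝ)
    (i : Fin m) (h : k ≤ ((Tuple.sort f).symm i : ℕ)) : orderStat k f ≤ f i := by
  rw [orderStat_eq hk hm]
  have := Tuple.monotone_sort f (b := (Tuple.sort f).symm i) (a := ⟨k - 1, by omega⟩)
    (by rw [Fin.le_def]; simp only; omega)
  simpa using this

theorem exists_eq_orderStat {m k : ℕ} (hk : 1 ≤ k) (hm : k ≤ m) (f : Fin m → ℝ) :
    ∃ i, ((Tuple.sort f).symm i : ℕ) < k ∧ f i = orderStat k f :=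
  ⟨Tuple.sort f ⟨k - 1, by omega⟩, by simp; omega, (orderStat_eq hk hm f).symm⟩

theorem le_orderStat {m k : ℕ} (hk : 1 ≤ k) (hm : k ≤ m) (f : Fin m → ℝ) (s : ℝ)
    (h : ∀ i, s ≤ f i) : s ≤ orderStat k f := by
  rw [orderStat_eq hk hm]
  exact h _

/-- The first `k` entries of a tuple are not affected by a change of the other entries to values
above the `k`-th smallest one. -/
theorem first_and_orderStat_eq_of_replace {m k : ℕ} (hk : 1 ≤ k) (hm : k ≤ m) (f g : Fin m → ℝ)
    (h : ∀ i, f i = g i ∨ (k ≤ ((Tuple.sort f).symm i : ℕ) ∧ orderStat k f < g i)) :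
    (∀ i, ((Tuple.sort g).symm i : ℕ) < k ↔ ((Tuple.sort f).symm i : ℕ) < k) ∧
      orderStat k g = orderStat k f := by
  have hfg : ∀ i, ((Tuple.sort f).symm i : ℕ) < k → f i = g i := fun i hi =>
    (h i).resolve_right (fun h' => by omega)
  -- The rank of such an `i` cannot grow: a replaced entry exceeds `orderStat k f ≥ f i`, so it does
  -- not precede `i` in `g`.
  have hsub : ∀ i, ((Tuple.sort f).symm i : ℕ) < k → ((Tuple.sort g).symm i : ℕ) < k := by
    intro i hi
    refine lt_of_le_of_lt ?_ hi
    rw [Tuple.sort_symm_eq_card, Tuple.sort_symm_eq_card]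
    refine Finset.card_le_card fun i' hi' => ?_
    have hfi := hfg i hi
    have hle := le_orderStat_of_sort_symm_lt hk hm f i hi
    simp only [Finset.mem_filter, Finset.mem_univ, true_and] at hi' ⊢
    rcases h i' with h1 | ⟨h1, h2⟩
    · rwa [h1, hfi]
    · rcases hi' with h3 | h3 <;> linarith
  have hset : (Finset.univ.filter fun i => ((Tuple.sort f).symm i : ℕ) < k)
      = Finset.univ.filter fun i => ((Tuple.sort g).symm i : ℕ) < k := by
    refine Finset.eq_of_subset_of_card_le (fun i => ?_) ?_
    · simpa using hsub i
    · rw [card_sort_symm_lt hm, card_sort_symm_lt hm]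
  refine ⟨fun i => ?_, le_antisymm ?_ ?_⟩
  · have := congrArg (i ∈ ·) hset
    simpa using this.symm
  · rw [orderStat_le_iff hk hm]
    refine (card_sort_symm_lt hm f).symm.le.trans ?_
    refine Finset.card_le_card fun i hi => ?_
    simp only [Finset.mem_filter, Finset.mem_univ, true_and] at hi ⊢
    rw [← hfg i hi]
    exact le_orderStat_of_sort_symm_lt hk hm f i hi
  · obtain ⟨i, hi, hfi⟩ := exists_eq_orderStat hk hm f
    rw [← hfi, hfg i hi]
    exact le_orderStat_of_sort_symm_lt hk hm g i (hsub i hi)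

/-! ### Pathwise properties of the dynamics -/

namespace KAsync

variable {P K : ℕ} (X Y : Fin P → ℕ → ℝ)

theorem step_count (s : State P) (i : Fin P) (h : (step K X s).count i = s.count i) :
    ¬ s.IsFirst K X i := by
  intro hf
  simp [step, hf] at h

theorem count_le_step (s : State P) (i : Fin P) : s.count i ≤ (step K X s).count i := by
  simp only [step]
  split_ifs <;> omega

theorem count_mono {j j' : ℕ} (h : j ≤ j') (i : Fin P) :
    (state K X j).count i ≤ (state K X j').count i := by
  induction h with
  | refl => rfl
  | step _ ih => exact ih.trans (count_le_step X _ i)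

theorem start_step_of_not_isFirst (s : State P) (i : Fin P) (h : ¬ s.IsFirst K X i) :
    (step K X s).start i = s.start i := by
  simp [step, h]

theorem start_eq_of_count_eq {j j' : ℕ} (hj : j ≤ j') (i : Fin P)
    (h : (state K X j').count i = (state K X j).count i) :
    (state K X j').start i = (state K X j).start i := by
  induction hj with
  | refl => rfl
  | @step l hl ih =>
    have h1 := count_mono (K := K) X hl i
    have h2 : (state K X l).count i ≤ _ := count_le_step (K := K) X (state K X l) i
    change (step K X (state K X l)).count i = _ at h
    change (step K X (state K X l)).start i = _
    rw [start_step_of_not_isFirst X _ i (step_count (K := K) X _ i (by omega)), ih (by omega)]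

theorem sum_count_step (hK : K ≤ P) (s : State P) :
    ∑ i, (step K X s).count i = ∑ i, s.count i + K := by
  classical
  have : ∀ i, (step K X s).count i = s.count i + if s.IsFirst K X i then 1 else 0 := by
    intro i
    simp only [step]
    split_ifs <;> rfl
  simp_rw [this, Finset.sum_add_distrib, Finset.sum_boole]
  congr 1
  rw [Nat.cast_id]
  refine (congrArg Finset.card (Finset.ext fun i => ?_)).trans (card_sort_symm_lt hK (s.finish X))
  rw [Finset.mem_filter, Finset.mem_filter]
  rfl

theorem sum_count_state (hK : K ≤ P) (j l : ℕ) :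
    ∑ i, (state K X (j + l)).count i = ∑ i, (state K X j).count i + l * K := by
  induction l with
  | zero => simp
  | succ l ih =>
    rw [← add_assoc]
    change ∑ i, (step K X _).count i = _
    rw [sum_count_step X hK, ih]
    ring

/-- After `n` updates by `K` out of `n * K` workers, the time is at most the time when all workers
have finished the mini-batches which they were working on. -/
theorem time_add_le {n : ℕ} (hn : 1 ≤ n) (hK : 1 ≤ K) (hP : P = n * K) (j : ℕ) (M : ℝ)
    (hM : ∀ i, (state K X j).finish X i ≤ M) : (state K X (j + n)).time ≤ M := by
  classical
  -- Count one iteration before the last: then at least `K` workers have a finishing time at most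
  -- `M`, which bounds the final update.
  obtain ⟨n, rfl⟩ : ∃ n', n = n' + 1 := ⟨n - 1, by omega⟩
  have hKP : K ≤ P := by rw [hP]; nlinarith
  change (step K X (state K X (j + n))).time ≤ M
  simp only [step]
  rw [orderStat_le_iff hK hKP]
  set s := state K X j
  set s' := state K X (j + n)
  have h1 : ∀ i, ¬ s'.finish X i ≤ M → s.count i + 1 ≤ s'.count i := by
    intro i hi
    by_contra hc
    have hc' : s'.count i = s.count i :=
      le_antisymm (by omega) (count_mono X (by omega) i)
    apply hi
    have := hM i
    unfold State.finish at this ⊢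
    rwa [start_eq_of_count_eq X (by omega) i hc', hc']
  have h2 : ∑ i, (s.count i + if ¬ s'.finish X i ≤ M then 1 else 0) ≤ ∑ i, s'.count i := by
    refine Finset.sum_le_sum fun i _ => ?_
    split_ifs with h
    · exact count_mono X (by omega) i
    · exact h1 i h
  have h4 : ∑ i, s'.count i = ∑ i, s.count i + n * K := sum_count_state X hKP j n
  rw [Finset.sum_add_distrib, h4, Finset.sum_boole] at h2
  have h3 := Finset.card_filter_add_card_filter_not (s := (Finset.univ : Finset (Fin P)))
    (fun i => s'.finish X i ≤ M)
  simp only [Finset.card_univ, Fintype.card_fin, Nat.cast_id] at h2 h3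
  have : P = n * K + K := by rw [hP]; ring
  omega

theorem time_le_finish (hK : 1 ≤ K) (hKP : K ≤ P) (hX : ∀ i k, 0 ≤ X i k) (j : ℕ) (i : Fin P) :
    (state K X j).time ≤ (state K X j).finish X i := by
  cases j with
  | zero => simpa [state, initial, State.finish] using hX i 0
  | succ j =>
    change (step K X (state K X j)).time ≤ (step K X (state K X j)).finish X i
    by_cases h : (state K X j).IsFirst K X i
    · simp only [State.finish, step, h, if_true]
      linarith [hX i ((state K X j).count i + 1)]
    · have h' := orderStat_le_of_le_sort_symm hK hKP _ i (not_lt.1 h)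
      simpa [State.finish, step, h] using h'

theorem time_mono (hK : 1 ≤ K) (hKP : K ≤ P) (hX : ∀ i k, 0 ≤ X i k) :
    Monotone fun j => (state K X j).time :=
  monotone_nat_of_le_succ fun j => le_orderStat hK hKP _ _ (time_le_finish X hK hKP hX j)

theorem start_le_time (hK : 1 ≤ K) (hKP : K ≤ P) (hX : ∀ i k, 0 ≤ X i k) (j : ℕ) (i : Fin P) :
    (state K X j).start i ≤ (state K X j).time := by
  induction j with
  | zero => simp [state, initial]
  | succ j ih =>
    have h := time_mono X hK hKP hX (Nat.le_succ j)
    simp only at h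
    by_cases hf : (state K X j).IsFirst K X i
    · simp [state, step, hf]
    · change (step K X _).start i ≤ _
      rw [start_step_of_not_isFirst X _ i hf]
      exact ih.trans h

theorem step_eq_of_replace (hK : 1 ≤ K) (hKP : K ≤ P) (s : State P)
    (h : ∀ i, s.finish X i = s.finish Y i ∨
      (¬ s.IsFirst K X i ∧ (step K X s).time < s.finish Y i)) :
    step K Y s = step K X s := by
  obtain ⟨h1, h2⟩ := first_and_orderStat_eq_of_replace hK hKP (s.finish X) (s.finish Y)
    (fun i => (h i).imp_right fun h' => ⟨not_lt.1 h'.1, h'.2⟩)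
  have h3 : ∀ i, s.IsFirst K Y i ↔ s.IsFirst K X i := h1
  simp only [step, h2]
  congr 1 <;> funext i <;> by_cases h : s.IsFirst K X i <;> simp [h, h3]

/-- The state after `j` iterations only depends on the mini-batches that have contributed, as long
as the other ones finish later. -/
theorem state_eq_of_replace (hK : 1 ≤ K) (hKP : K ≤ P) (hX : ∀ i k, 0 ≤ X i k) (j : ℕ)
    (hXY : ∀ i, ∀ k < (state K X j).count i, X i k = Y i k)
    (hY : ∀ i, (state K X j).time < (state K X j).start i + Y i ((state K X j).count i)) :
    state K Y j = state K X j := by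
  have : ∀ l ≤ j, state K Y l = state K X l := by
    intro l hl
    induction l with
    | zero => rfl
    | succ l ih =>
      have ih := ih (by omega)
      change step K Y (state K Y l) = step K X (state K X l)
      rw [ih]
      refine step_eq_of_replace X Y hK hKP _ fun i => ?_
      have hc := count_mono (K := K) X (show l ≤ j by omega) i
      have hc' := count_mono (K := K) X (show l ≤ l + 1 by omega) i
      have hc'' := count_mono (K := K) X hl i
      -- Either the mini-batch contributes before update `j`, and the arrays agree on it, or it is
      -- still running at update `j`, and its new finishing time lies beyond that update.
      rcases hc.lt_or_eq with h | h
      · left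
        simp only [State.finish, hXY i _ h]
      · right
        refine ⟨step_count X _ i (show (state K X (l + 1)).count i = _ by omega), ?_⟩
        have := hY i
        rw [start_eq_of_count_eq X (show l ≤ j by omega) i h.symm, ← h] at this
        exact lt_of_le_of_lt (time_mono X hK hKP hX hl) this
  exact this j le_rfl

end KAsync

/-! ### Measurability -/

theorem measurableSet_le_card_filter {α ι : Type*} [MeasurableSpace α] [Fintype ι]
    {p : α → ι → Prop} [∀ a, DecidablePred (p a)] (hp : ∀ i, MeasurableSet {a | p a i}) (k : ℕ) :
    MeasurableSet {a | k ≤ (Finset.univ.filter (p a)).card} := by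
  have : {a | k ≤ (Finset.univ.filter (p a)).card}
      = ⋃ T : Finset ι, {a | k ≤ T.card ∧ ∀ i ∈ T, p a i} := by
    ext a
    simp only [Set.mem_ofPred_eq, Set.mem_iUnion]
    exact ⟨fun h => ⟨_, h, by simp⟩, fun ⟨T, h1, h2⟩ =>
      h1.trans (Finset.card_le_card fun i hi => by simpa using h2 i hi)⟩
  rw [this]
  refine MeasurableSet.iUnion fun T => ?_
  refine (MeasurableSet.const _).inter ?_
  have : {a | ∀ i ∈ T, p a i} = ⋂ i ∈ T, {a | p a i} := by ext; simp
  change MeasurableSet {a | ∀ i ∈ T, p a i}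
  rw [this]
  exact Finset.measurableSet_biInter _ fun i _ => hp i

theorem measurable_orderStat {m k : ℕ} (hk : 1 ≤ k) (hm : k ≤ m) :
    Measurable (orderStat k : (Fin m → ℝ) → ℝ) := by
  refine measurable_of_Iic fun s => ?_
  have : orderStat k ⁻¹' Set.Iic s
      = {x : Fin m → ℝ | k ≤ (Finset.univ.filter fun i => x i ≤ s).card} := by
    ext x
    exact orderStat_le_iff hk hm x s
  rw [this]
  exact measurableSet_le_card_filter
    (fun i => measurableSet_le (measurable_pi_apply i) measurable_const) k

theorem measurableSet_sort_symm_lt {m : ℕ} (k : ℕ) (i : Fin m) :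
    MeasurableSet {x : Fin m → ℝ | ((Tuple.sort x).symm i : ℕ) < k} := by
  have : {x : Fin m → ℝ | ((Tuple.sort x).symm i : ℕ) < k}
      = {x : Fin m → ℝ | k ≤ (Finset.univ.filter fun i' =>
          x i' < x i ∨ x i' = x i ∧ i' < i).card}ᶜ := by
    ext x
    simp only [Set.mem_ofPred_eq, Set.mem_compl_iff, not_le, Tuple.sort_symm_eq_card]
  rw [this]
  refine (measurableSet_le_card_filter (fun i' => ?_) k).compl
  exact (measurableSet_lt (measurable_pi_apply i') (measurable_pi_apply i)).union
    ((measurableSet_eq_fun (measurable_pi_apply i') (measurable_pi_apply i)).inter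
      (MeasurableSet.const _))

namespace KAsync

theorem measurable_state {α : Type*} [MeasurableSpace α] {P K : ℕ} (hK : 1 ≤ K) (hKP : K ≤ P)
    {X : α → Fin P → ℕ → ℝ} (hX : ∀ i k, Measurable fun a => X a i k) (j : ℕ) :
    (Measurable fun a => (state K (X a) j).time) ∧
      (∀ i, Measurable fun a => (state K (X a) j).finish (X a) i) ∧
      (∀ i, Measurable fun a => (state K (X a) j).start i) ∧
      ∀ i, Measurable fun a => (state K (X a) j).count i := by
  have hfin : ∀ j, (∀ i, Measurable fun a => (state K (X a) j).start i) →
      (∀ i, Measurable fun a => (state K (X a) j).count i) →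
      ∀ i, Measurable fun a => (state K (X a) j).finish (X a) i := by
    intro j h1 h2 i
    -- The index of the current mini-batch is random; countability of `ℕ` makes evaluation there
    -- measurable.
    have h : Measurable fun q : α × ℕ => X q.1 i q.2 :=
      measurable_from_prod_countable_left fun k => hX i k
    exact (h1 i).add (h.comp (measurable_id.prodMk (h2 i)))
  induction j with
  | zero => exact ⟨measurable_const, hfin 0 (fun _ => measurable_const) fun _ => measurable_const,
      fun _ => measurable_const, fun _ => measurable_const⟩
  | succ j ih =>
    obtain ⟨ht, hf, hs, hc⟩ := ih
    have ht' : Measurable fun a => (state K (X a) (j + 1)).time :=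
      (measurable_orderStat hK hKP).comp (measurable_pi_lambda _ hf)
    have hF : ∀ i, MeasurableSet {a | (state K (X a) j).IsFirst K (X a) i} := fun i =>
      measurable_pi_lambda _ hf (measurableSet_sort_symm_lt K i)
    have hs' : ∀ i, Measurable fun a => (state K (X a) (j + 1)).start i := fun i =>
      Measurable.ite (hF i) ht' (hs i)
    have hc' : ∀ i, Measurable fun a => (state K (X a) (j + 1)).count i := fun i =>
      Measurable.ite (hF i) ((hc i).add_const 1) (hc i)
    exact ⟨ht', hfin _ hs' hc', hs', hc'⟩

end KAsync

/-! ### Residual lifetimes -/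

theorem orderStat_self_nonneg {m : ℕ} (hm : 1 ≤ m) {x : Fin m → ℝ} (h : ∀ i, 0 ≤ x i) :
    0 ≤ orderStat m x :=
  le_orderStat hm le_rfl x 0 h

theorem ae_pi_nonneg {m : ℕ} {ν : Measure ℝ} [IsProbabilityMeasure ν] (h0 : ∀ᵐ x ∂ν, 0 ≤ x) :
    ∀ᵐ w ∂(Measure.pi fun _ : Fin m => ν), ∀ i, 0 ≤ w i :=
  ae_all_iff.2 fun i => (measurePreserving_eval (fun _ : Fin m => ν) i).quasiMeasurePreserving.ae h0

/-- If `ν` is "new better than used", the largest of the residual lifetimes of `m` used items is on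
average at most the largest of the lifetimes of `m` new items. -/
theorem lintegral_max_residual_le {m : ℕ} (hm : 1 ≤ m) {ν : Measure ℝ} [IsProbabilityMeasure ν]
    (h0 : ∀ᵐ x ∂ν, 0 ≤ x)
    (hν : ∀ t s, 0 ≤ t → 0 ≤ s → ν (Set.Ici t) * ν (Set.Iic s) ≤ ν (Set.Icc t (t + s)))
    (τ : Fin m → ℝ) (hτ : ∀ i, 0 ≤ τ i) :
    ∫⁻ w in Set.univ.pi fun i => Set.Ici (τ i),
        ENNReal.ofReal (orderStat m fun i => w i - τ i) ∂(Measure.pi fun _ => ν)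
      ≤ (Measure.pi fun _ => ν) (Set.univ.pi fun i => Set.Ici (τ i))
        * ∫⁻ w, ENNReal.ofReal (orderStat m w) ∂(Measure.pi fun _ : Fin m => ν) := by
  set π := Measure.pi fun _ : Fin m => ν
  set B := Set.univ.pi fun i => Set.Ici (τ i) with hB
  have hBm : MeasurableSet B := MeasurableSet.univ_pi fun i => measurableSet_Ici
  have hmeas : Measurable fun w : Fin m → ℝ => orderStat m fun i => w i - τ i :=
    (measurable_orderStat hm le_rfl).comp
      (measurable_pi_lambda _ fun i => (measurable_pi_apply i).sub_const _)
  rw [lintegral_eq_lintegral_meas_lt (π.restrict B) _ hmeas.aemeasurable,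
    lintegral_eq_lintegral_meas_lt π _ (measurable_orderStat hm le_rfl).aemeasurable,
    ← lintegral_const_mul' _ _ (measure_ne_top _ _)]
  · refine setLIntegral_mono' measurableSet_Ioi fun t ht => ?_
    have ht : 0 ≤ t := le_of_lt ht
    have hE : MeasurableSet {w : Fin m → ℝ | t < orderStat m fun i => w i - τ i} :=
      measurableSet_lt measurable_const hmeas
    have hF : MeasurableSet {w : Fin m → ℝ | t < orderStat m w} :=
      measurableSet_lt measurable_const (measurable_orderStat hm le_rfl)
    rw [Measure.restrict_apply hE]
    have h1 : {w : Fin m → ℝ | t < orderStat m w}ᶜ = Set.univ.pi fun _ => Set.Iic t := by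
      ext w
      simp [orderStat_self_le_iff hm, Pi.le_def]
    have h2 : B \ {w : Fin m → ℝ | t < orderStat m fun i => w i - τ i}
        = Set.univ.pi fun i => Set.Icc (τ i) (τ i + t) := by
      ext w
      simp only [Set.mem_sdiff, Set.mem_ofPred_eq, not_lt, orderStat_self_le_iff hm, hB,
        Set.mem_pi, Set.mem_univ, true_implies, Set.mem_Ici, Set.mem_Icc, ← forall_and,
        sub_le_iff_le_add']
    -- After the layer-cake formula it suffices to compare tails. A maximum being at most `t` is a
    -- product event, so the one-dimensional inequality multiplies; complements are then taken
    -- inside `B`.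
    have h3 : π B * π {w : Fin m → ℝ | t < orderStat m w}ᶜ
        ≤ π (B \ {w : Fin m → ℝ | t < orderStat m fun i => w i - τ i}) := by
      rw [h1, h2, Measure.pi_pi, Measure.pi_pi, Measure.pi_pi, ← Finset.prod_mul_distrib]
      exact Finset.prod_le_prod' fun i _ => hν _ _ (hτ i) ht
    have h4 := measure_inter_add_sdiff (μ := π) B hE
    have h5 := congrArg (π B * ·) (measure_add_measure_compl (μ := π) hF)
    simp only [measure_univ, mul_one, mul_add] at h5
    rw [Set.inter_comm]
    refine ENNReal.le_of_add_le_add_right (a := π B * π {w : Fin m → ℝ | t < orderStat m w}ᶜ)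
      (ENNReal.mul_ne_top (measure_ne_top π B) (measure_ne_top π _)) ?_
    exact (add_le_add le_rfl h3).trans_eq (h4.trans h5.symm)
  · filter_upwards [ae_pi_nonneg h0] with w hw using orderStat_self_nonneg hm hw
  · filter_upwards [ae_restrict_mem hBm] with w hw
    exact orderStat_self_nonneg hm fun i => sub_nonneg.2 (hw i (Set.mem_univ i))

/-! ### Exponential and shifted exponential laws -/

theorem expMeasure_Iic {μ : ℝ} (hμ : 0 < μ) (x : ℝ) :
    expMeasure μ (Set.Iic x) = ENNReal.ofReal (1 - Real.exp (-(μ * max x 0))) := by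
  have := isProbabilityMeasure_expMeasure hμ
  rw [← ofReal_cdf, cdf_expMeasure_eq hμ]
  split_ifs with h
  · rw [max_eq_left h]
  · rw [max_eq_right (not_le.1 h).le]
    simp

theorem expMeasure_Ioi {μ : ℝ} (hμ : 0 < μ) (x : ℝ) :
    expMeasure μ (Set.Ioi x) = ENNReal.ofReal (Real.exp (-(μ * max x 0))) := by
  have := isProbabilityMeasure_expMeasure hμ
  have h1 : Real.exp (-(μ * max x 0)) ≤ 1 := by
    rw [Real.exp_le_one_iff]
    have := mul_nonneg hμ.le (le_max_right x 0)
    linarith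
  rw [← Set.compl_Iic, prob_compl_eq_one_sub measurableSet_Iic, expMeasure_Iic hμ,
    ← ENNReal.ofReal_one, ← ENNReal.ofReal_sub _ (by linarith)]
  congr 1
  ring

theorem expMeasure_nonneg {μ : ℝ} (hμ : 0 < μ) : ∀ᵐ x ∂(expMeasure μ), 0 ≤ x := by
  rw [ae_iff]
  refine measure_mono_null (t := Set.Iic 0) (fun x hx => (not_le.1 hx).le) ?_
  simp [expMeasure_Iic hμ]

instance nullSingletonClass_expMeasure (μ : ℝ) : NullSingletonClass (expMeasure μ) := by
  unfold expMeasure gammaMeasure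
  infer_instance

theorem isProbabilityMeasure_shiftedExp (Δ : ℝ) {μ : ℝ} (hμ : 0 < μ) :
    IsProbabilityMeasure (shiftedExp Δ μ) :=
  have := isProbabilityMeasure_expMeasure hμ
  Measure.isProbabilityMeasure_map (measurable_const_add Δ).aemeasurable

theorem shiftedExp_nonneg {Δ μ : ℝ} (hΔ : 0 ≤ Δ) (hμ : 0 < μ) : ∀ᵐ x ∂(shiftedExp Δ μ), 0 ≤ x := by
  rw [shiftedExp, ae_map_iff (measurable_const_add Δ).aemeasurable measurableSet_Ici]
  filter_upwards [expMeasure_nonneg hμ] with x hx using by positivity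

theorem shiftedExp_Iic (Δ : ℝ) {μ : ℝ} (hμ : 0 < μ) (x : ℝ) :
    shiftedExp Δ μ (Set.Iic x) = ENNReal.ofReal (1 - Real.exp (-(μ * max (x - Δ) 0))) := by
  rw [shiftedExp, Measure.map_apply (measurable_const_add Δ) measurableSet_Iic,
    Set.preimage_const_add_Iic, expMeasure_Iic hμ]

theorem shiftedExp_Ioi (Δ : ℝ) {μ : ℝ} (hμ : 0 < μ) (x : ℝ) :
    shiftedExp Δ μ (Set.Ioi x) = ENNReal.ofReal (Real.exp (-(μ * max (x - Δ) 0))) := by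
  rw [shiftedExp, Measure.map_apply (measurable_const_add Δ) measurableSet_Ioi,
    Set.preimage_const_add_Ioi, expMeasure_Ioi hμ]

instance nullSingletonClass_shiftedExp (Δ μ : ℝ) : NullSingletonClass (shiftedExp Δ μ) where
  measure_singleton x := by
    rw [shiftedExp, Measure.map_apply (measurable_const_add Δ) (measurableSet_singleton x)]
    have : (fun y => Δ + y) ⁻¹' {x} = {x - Δ} := by
      ext y
      simp only [Set.mem_preimage, Set.mem_singleton_iff]
      exact eq_sub_iff_add_eq'.symm
    rw [this, measure_singleton]

/-- The shifted exponential distribution is "new better than used". -/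
theorem shiftedExp_Ici_mul_Iic_le {Δ μ : ℝ} (hΔ : 0 ≤ Δ) (hμ : 0 < μ) (t s : ℝ) (ht : 0 ≤ t)
    (hs : 0 ≤ s) :
    shiftedExp Δ μ (Set.Ici t) * shiftedExp Δ μ (Set.Iic s)
      ≤ shiftedExp Δ μ (Set.Icc t (t + s)) := by
  have := isProbabilityMeasure_shiftedExp Δ hμ
  rw [show Set.Icc t (t + s) = Set.Ici t \ Set.Ioi (t + s) by ext; simp,
    measure_sdiff (Set.Ioi_subset_Ici (by linarith)) measurableSet_Ioi.nullMeasurableSet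
      (measure_ne_top _ _), ← measure_congr (Ioi_ae_eq_Ici (μ := shiftedExp Δ μ) (a := t)),
    shiftedExp_Ioi Δ hμ, shiftedExp_Ioi Δ hμ, shiftedExp_Iic Δ hμ,
    ← ENNReal.ofReal_mul (Real.exp_nonneg _), ← ENNReal.ofReal_sub _ (Real.exp_nonneg _)]
  refine ENNReal.ofReal_le_ofReal ?_
  rw [mul_sub, mul_one, ← Real.exp_add]
  refine sub_le_sub_left (Real.exp_le_exp.2 ?_) _
  -- The cumulative hazard is superadditive on nonnegative times because `Δ ≥ 0`.
  have : max (t - Δ) 0 + max (s - Δ) 0 ≤ max (t + s - Δ) 0 := by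
    rcases max_cases (t - Δ) 0 with h1 | h1 <;> rcases max_cases (s - Δ) 0 with h2 | h2 <;>
      rcases max_cases (t + s - Δ) 0 with h3 | h3 <;> linarith
  nlinarith

/-! ### Mean of the largest residual time -/

namespace KAsync

variable {P K : ℕ}

theorem state_eq_of_agree (hK : 1 ≤ K) (hKP : K ≤ P) (X Y : Fin P → ℕ → ℝ) (j : ℕ)
    (h : ∀ i, ∀ k ≤ (state K X j).count i, X i k = Y i k) : state K Y j = state K X j := by
  have : ∀ l ≤ j, state K Y l = state K X l := by
    intro l hl
    induction l with
    | zero => rfl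
    | succ l ih =>
      have ih := ih (by omega)
      change step K Y (state K Y l) = step K X (state K X l)
      rw [ih]
      refine step_eq_of_replace X Y hK hKP _ fun i => Or.inl ?_
      simp only [State.finish, h i _ (count_mono X (show l ≤ j by omega) i)]
  exact this j le_rfl

/-- The array of mini-batch times `u` where the `c i`-th entry of worker `i` is replaced by `w i`. -/
def replaceCurrent (c : Fin P → ℕ) (u : Fin P → ℕ → ℝ) (w : Fin P → ℝ) : Fin P → ℕ → ℝ :=
  fun i k => if k = c i then w i else u i k

/-- The time from the `j`-th update until all workers have finished their current mini-batches. -/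
noncomputable def maxResidual (K : ℕ) (X : Fin P → ℕ → ℝ) (j : ℕ) : ℝ :=
  orderStat P fun i => (state K X j).finish X i - (state K X j).time

theorem replaceCurrent_nonneg {c : Fin P → ℕ} {u : Fin P → ℕ → ℝ} {w : Fin P → ℝ}
    (hu : ∀ i k, 0 ≤ u i k) (hw : ∀ i, 0 ≤ w i) (i : Fin P) (k : ℕ) :
    0 ≤ replaceCurrent c u w i k := by
  unfold replaceCurrent
  split_ifs
  exacts [hw i, hu i k]

/-- The current mini-batches have not contributed yet, so any other current times strictly longer
than the ages produce the same history; strictness rules out ties. -/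
theorem state_replaceCurrent_eq (hK : 1 ≤ K) (hKP : K ≤ P) {c : Fin P → ℕ} {u : Fin P → ℕ → ℝ}
    (hu : ∀ i k, 0 ≤ u i k) (j : ℕ) {w w' : Fin P → ℝ} (hw : ∀ i, 0 ≤ w i)
    (hc : (state K (replaceCurrent c u w) j).count = c)
    (h : ∀ i, (state K (replaceCurrent c u w) j).time
      < (state K (replaceCurrent c u w) j).start i + w' i) :
    state K (replaceCurrent c u w') j = state K (replaceCurrent c u w) j := by
  refine state_eq_of_replace _ _ hK hKP (replaceCurrent_nonneg hu hw) j (fun i k hk => ?_)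
    fun i => ?_
  · rw [hc] at hk
    simp [replaceCurrent, hk.ne]
  · rw [hc]
    simpa [replaceCurrent] using h i

variable {α : Type*} [MeasurableSpace α]

theorem measurable_maxResidual (hK : 1 ≤ K) (hKP : K ≤ P) {X : α → Fin P → ℕ → ℝ}
    (hX : ∀ i k, Measurable fun a => X a i k) (j : ℕ) :
    Measurable fun a => maxResidual K (X a) j :=
  have h := measurable_state hK hKP hX j
  (measurable_orderStat (hK.trans hKP) le_rfl).comp
    (measurable_pi_lambda _ fun i => (h.2.1 i).sub h.1)

theorem measurableSet_count_eq (hK : 1 ≤ K) (hKP : K ≤ P) {X : α → Fin P → ℕ → ℝ}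
    (hX : ∀ i k, Measurable fun a => X a i k) (j : ℕ) (c : Fin P → ℕ) :
    MeasurableSet {a | (state K (X a) j).count = c} :=
  have h := measurable_state hK hKP hX j
  measurableSet_eq_fun (measurable_pi_lambda _ h.2.2.2) measurable_const

theorem measurable_replaceCurrent (c : Fin P → ℕ) (i : Fin P) (k : ℕ) :
    Measurable fun q : (Fin P → ℕ → ℝ) × (Fin P → ℝ) => replaceCurrent c q.1 q.2 i k := by
  unfold replaceCurrent
  split_ifs <;> fun_prop

/-- The pairs of past and current mini-batch times for which worker `i` has contributed exactly
`c i` mini-batches after `j` iterations. -/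
def countSet (K : ℕ) (c : Fin P → ℕ) (j : ℕ) : Set ((Fin P → ℕ → ℝ) × (Fin P → ℝ)) :=
  {q | (∀ i, 0 ≤ q.2 i) ∧ (state K (replaceCurrent c q.1 q.2) j).count = c}

theorem measurableSet_countSet (hK : 1 ≤ K) (hKP : K ≤ P) (c : Fin P → ℕ) (j : ℕ) :
    MeasurableSet (countSet K c j) := by
  refine MeasurableSet.inter ?_ (measurableSet_count_eq hK hKP (measurable_replaceCurrent c) j c)
  change MeasurableSet {q : (Fin P → ℕ → ℝ) × (Fin P → ℝ) | ∀ i, 0 ≤ q.2 i}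
  rw [Set.ofPred_forall]
  exact MeasurableSet.iInter fun i => measurableSet_le measurable_const
    ((measurable_pi_apply i).comp measurable_snd)

/-- For a fixed past `u`, a nonempty section of `countSet` lies between the open and the closed
orthant with corner `τ`, the vector of ages, and the state is constant on it. This reduces the claim
to `lintegral_max_residual_le`. -/
theorem lintegral_section_le (hK : 1 ≤ K) (hKP : K ≤ P) {ν : Measure ℝ} [IsProbabilityMeasure ν]
    [NullSingletonClass ν] (h0 : ∀ᵐ x ∂ν, 0 ≤ x)
    (hν : ∀ t s, 0 ≤ t → 0 ≤ s → ν (Set.Ici t) * ν (Set.Iic s) ≤ ν (Set.Icc t (t + s)))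
    (c : Fin P → ℕ) {u : Fin P → ℕ → ℝ} (hu : ∀ i k, 0 ≤ u i k) (j : ℕ) :
    ∫⁻ w in Prod.mk u ⁻¹' countSet K c j,
        ENNReal.ofReal (maxResidual K (replaceCurrent c u w) j) ∂(Measure.pi fun _ => ν)
      ≤ (Measure.pi fun _ => ν) (Prod.mk u ⁻¹' countSet K c j)
        * ∫⁻ w, ENNReal.ofReal (orderStat P w) ∂(Measure.pi fun _ : Fin P => ν) := by
  set A := Prod.mk u ⁻¹' countSet K c j
  have hA : MeasurableSet A := measurable_prodMk_left (measurableSet_countSet hK hKP c j)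
  rcases A.eq_empty_or_nonempty with hAe | ⟨w₀, hw₀⟩
  · simp [hAe]
  set s := state K (replaceCurrent c u w₀) j with hs
  have hs_eq : ∀ w ∈ A, state K (replaceCurrent c u w) j = s := by
    intro w hw
    -- Current times longer than the ages in both histories; each history is unchanged on passing to
    -- `w₁`, so the two coincide.
    let w₁ : Fin P → ℝ := fun i =>
      max (s.time - s.start i) ((state K (replaceCurrent c u w) j).time
        - (state K (replaceCurrent c u w) j).start i) + 1
    have h1 : state K (replaceCurrent c u w₁) j = state K (replaceCurrent c u w) j := by
      refine state_replaceCurrent_eq hK hKP hu j hw.1 hw.2 fun i => ?_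
      have := le_max_right (s.time - s.start i) ((state K (replaceCurrent c u w) j).time
        - (state K (replaceCurrent c u w) j).start i)
      simp only [w₁]
      linarith
    have h2 : state K (replaceCurrent c u w₁) j = s := by
      refine state_replaceCurrent_eq hK hKP hu j hw₀.1 hw₀.2 fun i => ?_
      have := le_max_left (s.time - s.start i) ((state K (replaceCurrent c u w) j).time
        - (state K (replaceCurrent c u w) j).start i)
      simp only [w₁]
      linarith
    rw [← h1, h2]
  have hfin : ∀ w ∈ A, ∀ i, s.finish (replaceCurrent c u w) i = s.start i + w i := by
    intro w _ i
    have : s.count = c := hw₀.2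
    simp [State.finish, replaceCurrent, this]
  set τ : Fin P → ℝ := fun i => s.time - s.start i with hτ
  have hτ0 : ∀ i, 0 ≤ τ i := fun i =>
    sub_nonneg.2 (start_le_time _ hK hKP (replaceCurrent_nonneg hu hw₀.1) j i)
  have hAB : A ⊆ Set.univ.pi fun i => Set.Ici (τ i) := by
    intro w hw i _
    have := time_le_finish _ hK hKP (replaceCurrent_nonneg (c := c) hu hw.1) j i
    rw [hs_eq w hw, hfin w hw] at this
    simp only [hτ, Set.mem_Ici]
    linarith
  have hBA : (Set.univ.pi fun i => Set.Ioi (τ i)) ⊆ A := by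
    intro w hw
    have hw' : ∀ i, τ i < w i := fun i => hw i (Set.mem_univ i)
    have : state K (replaceCurrent c u w) j = s :=
      state_replaceCurrent_eq hK hKP hu j hw₀.1 hw₀.2 fun i => by
        have := hw' i
        simp only [hτ] at this
        linarith
    refine ⟨fun i => (hτ0 i).trans (hw' i).le, ?_⟩
    change (state K (replaceCurrent c u w) j).count = c
    rw [this]
    exact hw₀.2
  calc ∫⁻ w in A, ENNReal.ofReal (maxResidual K (replaceCurrent c u w) j) ∂(Measure.pi fun _ => ν)
      = ∫⁻ w in A, ENNReal.ofReal (orderStat P fun i => w i - τ i) ∂(Measure.pi fun _ => ν) := by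
        refine setLIntegral_congr_fun hA fun w hw => ?_
        simp only [maxResidual]
        rw [hs_eq w hw]
        simp only [hfin w hw, hτ]
        congr 3
        funext i
        ring
    _ ≤ ∫⁻ w in Set.univ.pi fun i => Set.Ici (τ i),
          ENNReal.ofReal (orderStat P fun i => w i - τ i) ∂(Measure.pi fun _ => ν) :=
        lintegral_mono_set hAB
    _ ≤ _ := lintegral_max_residual_le (hK.trans hKP) h0 hν τ hτ0
    _ ≤ _ := by
        -- Without atoms, the open and the closed orthant have equal measure.
        refine mul_le_mul' (le_trans (le_of_eq ?_) (measure_mono hBA)) le_rfl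
        rw [Measure.pi_pi, Measure.pi_pi]
        exact Finset.prod_congr rfl fun i _ => (measure_congr Ioi_ae_eq_Ici).symm

/-- The residual time until all workers have finished their current mini-batches is on average at
most the maximum of the times of `P` new mini-batches. -/
theorem lintegral_maxResidual_le {Ω : Type*} [MeasurableSpace Ω] {Pr : Measure Ω}
    [IsProbabilityMeasure Pr] (hK : 1 ≤ K) (hKP : K ≤ P) {ν : Measure ℝ} [IsProbabilityMeasure ν]
    [NullSingletonClass ν] (h0 : ∀ᵐ x ∂ν, 0 ≤ x)
    (hν : ∀ t s, 0 ≤ t → 0 ≤ s → ν (Set.Ici t) * ν (Set.Iic s) ≤ ν (Set.Icc t (t + s)))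
    {X : Fin P → ℕ → Ω → ℝ} (hX : ∀ i k, Measurable (X i k)) (hX0 : ∀ i k ω, 0 ≤ X i k ω)
    (hlaw : ∀ i k, Pr.map (X i k) = ν)
    (hindep : iIndepFun (fun p : Fin P × ℕ => X p.1 p.2) Pr) (j : ℕ) :
    ∫⁻ ω, ENNReal.ofReal (maxResidual K (fun i k => X i k ω) j) ∂Pr
      ≤ ∫⁻ w, ENNReal.ofReal (orderStat P w) ∂(Measure.pi fun _ : Fin P => ν) := by
  set C := ∫⁻ w, ENNReal.ofReal (orderStat P w) ∂(Measure.pi fun _ : Fin P => ν)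
  set E : (Fin P → ℕ) → Set Ω := fun c => {ω | (state K (fun i k => X i k ω) j).count = c}
  have hEm : ∀ c, MeasurableSet (E c) := measurableSet_count_eq hK hKP hX j
  have hEd : Pairwise (Function.onFun Disjoint E) := by
    intro c c' hcc
    refine Set.disjoint_left.2 fun ω h h' => hcc ?_
    rw [← show _ = c from h, ← show _ = c' from h']
  have hEu : ⋃ c, E c = Set.univ := Set.eq_univ_of_forall fun ω => Set.mem_iUnion.2 ⟨_, rfl⟩
  have key : ∀ c, ∫⁻ ω in E c, ENNReal.ofReal (maxResidual K (fun i k => X i k ω) j) ∂Pr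
      ≤ Pr (E c) * C := by
    intro c
    -- `U` holds the completed mini-batches and `W` the current ones. They use disjoint index sets,
    -- hence are independent. The filler `0` is never read when the counts equal `c`, and it keeps
    -- the array nonnegative.
    let U : Ω → Fin P → ℕ → ℝ := fun ω i k => if k < c i then X i k ω else 0
    let W : Ω → Fin P → ℝ := fun ω i => X i (c i) ω
    have hU : Measurable U := measurable_pi_lambda _ fun i => measurable_pi_lambda _ fun k => by
      simp only [U]
      split_ifs
      exacts [hX i k, measurable_const]
    have hW : Measurable W := measurable_pi_lambda _ fun i => hX i _
    have hU0 : ∀ᵐ u ∂(Pr.map U), ∀ i k, 0 ≤ u i k := by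
      simp_rw [ae_all_iff]
      intro i k
      have hm : MeasurableSet {u : Fin P → ℕ → ℝ | 0 ≤ u i k} := measurableSet_le measurable_const
        ((measurable_pi_apply k).comp (measurable_pi_apply i))
      rw [ae_map_iff hU.aemeasurable hm]
      refine Filter.Eventually.of_forall fun ω => ?_
      simp only [U]
      split_ifs
      exacts [hX0 _ _ _, le_rfl]
    have hWlaw : Pr.map W = Measure.pi fun _ => ν := by
      have := hindep.precomp (g := fun i : Fin P => (i, c i)) fun a b h => (Prod.ext_iff.1 h).1
      rw [iIndepFun_iff_map_fun_eq_pi_map fun i => (hX _ _).aemeasurable] at this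
      simpa only [Function.comp_def, hlaw] using this
    have hUW : IndepFun U W Pr := by
      let S : Finset (Fin P × ℕ) := Finset.univ.biUnion fun i =>
        (Finset.range (c i)).image fun k => (i, k)
      let T : Finset (Fin P × ℕ) := Finset.univ.image fun i => (i, c i)
      have hST : Disjoint S T := by
        rw [Finset.disjoint_left]
        rintro ⟨i, k⟩ h h'
        simp only [S, T, Finset.mem_biUnion, Finset.mem_image, Finset.mem_univ, true_and,
          Finset.mem_range, Prod.mk.injEq] at h h'
        grind
      have hS : ∀ i k, k < c i → (i, k) ∈ S := by
        intro i k h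
        simp only [S, Finset.mem_biUnion, Finset.mem_image, Finset.mem_univ, true_and,
          Finset.mem_range, Prod.mk.injEq]
        exact ⟨i, k, h, rfl, rfl⟩
      have hT : ∀ i, (i, c i) ∈ T := fun i => Finset.mem_image.2 ⟨i, Finset.mem_univ i, rfl⟩
      have h := hindep.indepFun_finset S T hST fun p => hX p.1 p.2
      refine h.comp (φ := fun a i k => if h : k < c i then a ⟨(i, k), hS i k h⟩ else 0)
        (ψ := fun a i => a ⟨(i, c i), hT i⟩) ?_ ?_
      · refine measurable_pi_lambda _ fun i => measurable_pi_lambda _ fun k => ?_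
        split_ifs
        exacts [measurable_pi_apply _, measurable_const]
      · exact measurable_pi_lambda _ fun i => measurable_pi_apply _
    have hmap : Pr.map (fun ω => (U ω, W ω)) = (Pr.map U).prod (Measure.pi fun _ => ν) := by
      rw [(indepFun_iff_map_prod_eq_prod_map_map hU.aemeasurable hW.aemeasurable).1 hUW, hWlaw]
    have hUWm : Measurable fun ω => (U ω, W ω) := hU.prodMk hW
    have hagree : ∀ ω i, ∀ k ≤ c i, X i k ω = replaceCurrent c (U ω) (W ω) i k := by
      intro ω i k hk
      simp only [replaceCurrent, U, W]
      rcases hk.lt_or_eq with h | h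
      · simp [h, h.ne]
      · simp [h]
    have hst : ∀ ω ∈ E c, state K (replaceCurrent c (U ω) (W ω)) j
        = state K (fun i k => X i k ω) j := by
      intro ω hω
      refine state_eq_of_agree hK hKP _ _ j fun i k hk => hagree ω i k ?_
      rwa [show _ = c from hω] at hk
    -- Either membership fixes the counts to be `c`, so only entries with `k ≤ c i` matter, where
    -- both arrays agree.
    have hEc : E c = (fun ω => (U ω, W ω)) ⁻¹' countSet K c j := by
      ext ω
      refine ⟨fun hω => ⟨fun i => hX0 _ _ _, ?_⟩, fun hω => ?_⟩
      · simp only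
        rw [hst ω hω]
        exact hω
      · have h2 : (state K (replaceCurrent c (U ω) (W ω)) j).count = c := hω.2
        have : state K (fun i k => X i k ω) j = state K (replaceCurrent c (U ω) (W ω)) j := by
          refine state_eq_of_agree hK hKP _ _ j fun i k hk => (hagree ω i k ?_).symm
          rwa [h2] at hk
        change (state K (fun i k => X i k ω) j).count = c
        rw [this, h2]
    have hAm := measurableSet_countSet hK hKP c j
    have hZm : Measurable fun q : (Fin P → ℕ → ℝ) × (Fin P → ℝ) =>
        ENNReal.ofReal (maxResidual K (replaceCurrent c q.1 q.2) j) :=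
      (measurable_maxResidual hK hKP (measurable_replaceCurrent c) j).ennreal_ofReal
    calc ∫⁻ ω in E c, ENNReal.ofReal (maxResidual K (fun i k => X i k ω) j) ∂Pr
        = ∫⁻ ω in (fun ω => (U ω, W ω)) ⁻¹' countSet K c j,
            ENNReal.ofReal (maxResidual K (replaceCurrent c (U ω) (W ω)) j) ∂Pr := by
          rw [← hEc]
          refine setLIntegral_congr_fun (hEm c) fun ω hω => ?_
          have hc : (state K (fun i k => X i k ω) j).count = c := hω
          simp only [maxResidual, hst ω hω, State.finish, hc, ← hagree ω _ _ le_rfl]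
      _ = ∫⁻ q in countSet K c j, ENNReal.ofReal (maxResidual K (replaceCurrent c q.1 q.2) j)
            ∂((Pr.map U).prod (Measure.pi fun _ => ν)) := by
          rw [← hmap, setLIntegral_map hAm hZm hUWm]
      _ = ∫⁻ u, ∫⁻ w in Prod.mk u ⁻¹' countSet K c j,
            ENNReal.ofReal (maxResidual K (replaceCurrent c u w) j) ∂(Measure.pi fun _ => ν)
            ∂(Pr.map U) := by
          rw [← lintegral_indicator hAm, lintegral_prod _ (hZm.indicator hAm).aemeasurable]
          refine lintegral_congr fun u => ?_
          rw [← lintegral_indicator (measurable_prodMk_left hAm)]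
          rfl
      _ ≤ ∫⁻ u, (Measure.pi fun _ => ν) (Prod.mk u ⁻¹' countSet K c j) * C ∂(Pr.map U) := by
          refine lintegral_mono_ae ?_
          filter_upwards [hU0] with u hu using lintegral_section_le hK hKP h0 hν c hu j
      _ = Pr (E c) * C := by
          rw [lintegral_mul_const _ (measurable_measure_prodMk_left hAm),
            ← Measure.prod_apply hAm, ← hmap, Measure.map_apply hUWm hAm, hEc]
  calc ∫⁻ ω, ENNReal.ofReal (maxResidual K (fun i k => X i k ω) j) ∂Pr
      = ∑' c, ∫⁻ ω in E c, ENNReal.ofReal (maxResidual K (fun i k => X i k ω) j) ∂Pr := by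
        rw [← lintegral_iUnion hEm hEd, hEu, Measure.restrict_univ]
    _ ≤ ∑' c, Pr (E c) * C := ENNReal.tsum_le_tsum key
    _ = C := by
        rw [ENNReal.tsum_mul_right, ← measure_iUnion hEd hEm, hEu, measure_univ, one_mul]

end KAsync

/-! ### Means of exponential order statistics -/

theorem lintegral_orderStat_eq {k m : ℕ} (hk : 1 ≤ k) (hm : k ≤ m) {μ : ℝ} (hμ : 0 < μ) :
    ∫⁻ x : Fin m → ℝ, ENNReal.ofReal (orderStat k x) ∂(Measure.pi fun _ => expMeasure μ)
      = ∫⁻ t in Set.Ioi (0 : ℝ), (Measure.pi fun _ : Fin m => expMeasure μ)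
          {x | (Finset.univ.filter fun i => x i ≤ t).card < k} := by
  have := isProbabilityMeasure_expMeasure hμ
  rw [lintegral_eq_lintegral_meas_lt _ ?_ (measurable_orderStat hk hm).aemeasurable]
  · refine lintegral_congr fun t => congrArg _ (Set.ext fun x => ?_)
    change t < orderStat k x ↔ _ < k
    rw [← not_le, orderStat_le_iff hk hm, not_le]
  · filter_upwards [ae_pi_nonneg (expMeasure_nonneg hμ)] with x hx using le_orderStat hk hm x 0 hx

/-- The number of successes before time `t` has a binomial distribution. -/
theorem pi_expMeasure_card_eq {m : ℕ} {μ : ℝ} (hμ : 0 < μ) (r : ℕ) {t : ℝ} (ht : 0 ≤ t) :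
    (Measure.pi fun _ : Fin m => expMeasure μ)
        {x | (Finset.univ.filter fun i => x i ≤ t).card = r}
      = ENNReal.ofReal (m.choose r *
          ((1 - Real.exp (-(μ * t))) ^ r * Real.exp (-(μ * t)) ^ (m - r))) := by
  have := isProbabilityMeasure_expMeasure hμ
  have he : 0 ≤ 1 - Real.exp (-(μ * t)) :=
    sub_nonneg.2 (Real.exp_le_one_iff.2 (by nlinarith))
  have hset : {x : Fin m → ℝ | (Finset.univ.filter fun i => x i ≤ t).card = r}
      = ⋃ T ∈ Finset.univ.powersetCard r,
          Set.univ.pi fun i : Fin m => if i ∈ T then Set.Iic t else Set.Ioi t := by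
    ext x
    simp only [Set.mem_iUnion, Finset.mem_powersetCard, Finset.subset_univ, true_and, exists_prop,
      Set.mem_pi, Set.mem_univ, true_implies]
    constructor
    · intro h
      refine ⟨_, h, fun i => ?_⟩
      by_cases hi : x i ≤ t
      · simp [hi]
      · simp [hi, not_le.1 hi]
    · rintro ⟨T, hT, h⟩
      rw [← hT]
      change Finset.card _ = _
      congr 1
      ext i
      have := h i
      by_cases hi : i ∈ T
      · simpa [hi] using this
      · simpa [hi] using this
  rw [hset, measure_biUnion_finset]
  · have : ∀ T ∈ (Finset.univ : Finset (Fin m)).powersetCard r,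
        (Measure.pi fun _ : Fin m => expMeasure μ)
          (Set.univ.pi fun i : Fin m => if i ∈ T then Set.Iic t else Set.Ioi t)
        = ENNReal.ofReal ((1 - Real.exp (-(μ * t))) ^ r * Real.exp (-(μ * t)) ^ (m - r)) := by
      intro T hT
      have hT' := (Finset.mem_powersetCard.1 hT).2
      rw [Measure.pi_pi]
      have : ∀ i, expMeasure μ (if i ∈ T then Set.Iic t else Set.Ioi t)
          = if i ∈ T then ENNReal.ofReal (1 - Real.exp (-(μ * t)))
            else ENNReal.ofReal (Real.exp (-(μ * t))) := by
        intro i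
        split_ifs
        · rw [expMeasure_Iic hμ, max_eq_left ht]
        · rw [expMeasure_Ioi hμ, max_eq_left ht]
      simp_rw [this]
      rw [Finset.prod_ite, Finset.prod_const, Finset.prod_const, Finset.filter_univ_mem, hT',
        Finset.filter_notMem_eq_sdiff, Finset.card_univ_sdiff, hT', Fintype.card_fin,
        ENNReal.ofReal_mul (pow_nonneg he _), ENNReal.ofReal_pow he,
        ENNReal.ofReal_pow (Real.exp_nonneg _)]
    rw [Finset.sum_congr rfl this, Finset.sum_const, Finset.card_powersetCard, Finset.card_univ,
      Fintype.card_fin, nsmul_eq_mul, ENNReal.ofReal_mul (Nat.cast_nonneg _),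
      ENNReal.ofReal_natCast]
  · intro T _ T' _ hTT
    refine Set.disjoint_left.2 fun x hx hx' => hTT (Finset.ext fun i => ?_)
    have h1 := hx i (Set.mem_univ i)
    have h2 := hx' i (Set.mem_univ i)
    by_cases hi : i ∈ T <;> by_cases hi' : i ∈ T' <;> simp_all
    · exact absurd h1 (not_le.2 h2)
    · exact absurd h2 (not_le.2 h1)
  · intro T _
    refine MeasurableSet.univ_pi fun i => ?_
    split_ifs
    exacts [measurableSet_Iic, measurableSet_Ioi]

/-- A Beta integral, by induction on `r` for all `a` at once: splitting off one factor `1 - e` gives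
a difference of the integrals for `a` and `a + 1`. The identities `e1` and `e2` match the binomial
coefficients. -/
theorem integral_one_sub_exp_pow {μ : ℝ} (hμ : 0 < μ) (r : ℕ) : ∀ a : ℕ, 1 ≤ a →
    IntegrableOn (fun t => (1 - Real.exp (-(μ * t))) ^ r * Real.exp (-(μ * t)) ^ a) (Set.Ioi 0) ∧
    (r + a).choose r * ∫ t in Set.Ioi (0 : ℝ),
      (1 - Real.exp (-(μ * t))) ^ r * Real.exp (-(μ * t)) ^ a = 1 / (μ * a) := by
  induction r with
  | zero =>
    intro a ha
    have ha' : (0 : ℝ) < a := by exact_mod_cast ha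
    have : ∀ t : ℝ, (1 - Real.exp (-(μ * t))) ^ 0 * Real.exp (-(μ * t)) ^ a
        = Real.exp (-(μ * a) * t) := by
      intro t
      rw [pow_zero, one_mul, ← Real.exp_nat_mul]
      ring_nf
    simp_rw [this]
    refine ⟨exp_neg_integrableOn_Ioi _ (by positivity), ?_⟩
    rw [integral_exp_mul_Ioi (by nlinarith [mul_pos hμ ha'])]
    simp
  | succ r ih =>
    intro a ha
    have ha' : (0 : ℝ) < a := by exact_mod_cast ha
    obtain ⟨h1, h2⟩ := ih a ha
    obtain ⟨h3, h4⟩ := ih (a + 1) (by omega)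
    have : ∀ t : ℝ, (1 - Real.exp (-(μ * t))) ^ (r + 1) * Real.exp (-(μ * t)) ^ a
        = (1 - Real.exp (-(μ * t))) ^ r * Real.exp (-(μ * t)) ^ a
          - (1 - Real.exp (-(μ * t))) ^ r * Real.exp (-(μ * t)) ^ (a + 1) := by
      intro t
      ring
    simp_rw [this]
    refine ⟨h1.sub h3, ?_⟩
    rw [integral_sub h1 h3, mul_sub]
    have e1 : ((r + 1 + a).choose (r + 1) : ℝ) * (r + 1) = (r + a).choose r * (r + 1 + a) := by
      have := Nat.add_one_mul_choose_eq (r + a) r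
      rw [show r + a + 1 = r + 1 + a by ring] at this
      have h := congrArg (Nat.cast (R := ℝ)) this
      push_cast at h
      linarith
    have e2 : ((r + 1 + a).choose (r + 1) : ℝ) * (r + 1) = (r + (a + 1)).choose r * (a + 1) := by
      have := Nat.choose_succ_right_eq (r + 1 + a) r
      rw [show r + 1 + a - r = a + 1 by omega] at this
      rw [show r + (a + 1) = r + 1 + a by ring]
      exact_mod_cast this
    set I := ∫ t in Set.Ioi (0 : ℝ), (1 - Real.exp (-(μ * t))) ^ r * Real.exp (-(μ * t)) ^ a
    set J := ∫ t in Set.Ioi (0 : ℝ),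
      (1 - Real.exp (-(μ * t))) ^ r * Real.exp (-(μ * t)) ^ (a + 1)
    set N : ℝ := ((r + 1 + a).choose (r + 1) : ℝ)
    have hr : (r : ℝ) + 1 ≠ 0 := by positivity
    have f1 : N * I * (r + 1) = (r + 1 + a) / (μ * a) := by
      calc N * I * (r + 1) = (N * (r + 1)) * I := by ring
        _ = ((r + a).choose r * I) * (r + 1 + a) := by rw [e1]; ring
        _ = _ := by rw [h2]; ring
    have f2 : N * J * (r + 1) = 1 / μ := by
      calc N * J * (r + 1) = (N * (r + 1)) * J := by ring
        _ = ((r + (a + 1)).choose r * J) * (a + 1) := by rw [e2]; ring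
        _ = _ := by
          rw [h4]
          push_cast
          field_simp
    have f3 : (N * I - N * J) * (r + 1) = (r + 1) / (μ * a) := by
      rw [sub_mul, f1, f2]
      field_simp
      ring
    rw [← mul_left_inj' hr, f3]
    ring

/-- The tail at `t` is the probability of fewer than `k` values up to `t`, a sum of binomial
weights; the weight of `r` integrates to `1 / (μ (m - r))`. -/
theorem lintegral_orderStat_expMeasure {k m : ℕ} (hk : 1 ≤ k) (hm : k ≤ m) {μ : ℝ} (hμ : 0 < μ) :
    ∫⁻ x : Fin m → ℝ, ENNReal.ofReal (orderStat k x) ∂(Measure.pi fun _ => expMeasure μ)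
      = ENNReal.ofReal (∑ r ∈ Finset.range k, 1 / (μ * (m - r : ℝ))) := by
  have := isProbabilityMeasure_expMeasure hμ
  rw [lintegral_orderStat_eq hk hm hμ]
  have hcard : ∀ (r : ℕ) (t : ℝ),
      MeasurableSet {x : Fin m → ℝ | (Finset.univ.filter fun i => x i ≤ t).card = r} := by
    intro r t
    have h := measurableSet_le_card_filter (p := fun (x : Fin m → ℝ) i => x i ≤ t)
      (fun i => measurableSet_le (measurable_pi_apply i) measurable_const)
    have : {x : Fin m → ℝ | (Finset.univ.filter fun i => x i ≤ t).card = r}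
        = {x : Fin m → ℝ | r ≤ (Finset.univ.filter fun i => x i ≤ t).card}
          \ {x : Fin m → ℝ | r + 1 ≤ (Finset.univ.filter fun i => x i ≤ t).card} := by
      ext x
      simp only [Set.mem_sdiff, Set.mem_ofPred_eq]
      omega
    rw [this]
    exact (h r).diff (h (r + 1))
  have hsum : ∀ t : ℝ, (Measure.pi fun _ : Fin m => expMeasure μ)
      {x | (Finset.univ.filter fun i => x i ≤ t).card < k}
      = ∑ r ∈ Finset.range k, (Measure.pi fun _ : Fin m => expMeasure μ)
          {x | (Finset.univ.filter fun i => x i ≤ t).card = r} := by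
    intro t
    rw [← measure_biUnion_finset]
    · congr 1
      ext x
      simp
    · intro r _ r' _ hr
      exact Set.disjoint_left.2 fun x hx hx' => hr ((show _ = r from hx).symm.trans hx')
    · exact fun r _ => hcard r t
  have hg0 : ∀ r : ℕ, ∀ t ∈ Set.Ioi (0 : ℝ), 0 ≤ (m.choose r : ℝ) *
      ((1 - Real.exp (-(μ * t))) ^ r * Real.exp (-(μ * t)) ^ (m - r)) := by
    intro r t ht
    have ht : 0 < t := ht
    have : 0 ≤ 1 - Real.exp (-(μ * t)) :=
      sub_nonneg.2 (Real.exp_le_one_iff.2 (by nlinarith))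
    positivity
  calc _ = ∫⁻ t in Set.Ioi (0 : ℝ), ∑ r ∈ Finset.range k, ENNReal.ofReal (m.choose r *
          ((1 - Real.exp (-(μ * t))) ^ r * Real.exp (-(μ * t)) ^ (m - r))) := by
        refine setLIntegral_congr_fun measurableSet_Ioi fun t ht => ?_
        rw [hsum]
        exact Finset.sum_congr rfl fun r _ => pi_expMeasure_card_eq hμ r (le_of_lt ht)
    _ = ∑ r ∈ Finset.range k, ENNReal.ofReal (1 / (μ * (m - r : ℝ))) := by
        rw [lintegral_finsetSum' _ fun r _ => by fun_prop]
        refine Finset.sum_congr rfl fun r hr => ?_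
        have hr : r < k := Finset.mem_range.1 hr
        obtain ⟨h1, h2⟩ := integral_one_sub_exp_pow hμ r (m - r) (by omega)
        rw [show r + (m - r) = m by omega, ← integral_const_mul, Nat.cast_sub (by omega)] at h2
        rw [← h2, ofReal_integral_eq_lintegral_ofReal (h1.const_mul _)]
        filter_upwards [ae_restrict_mem measurableSet_Ioi] with t ht using hg0 r t ht
    _ = _ := by
        rw [ENNReal.ofReal_sum_of_nonneg]
        intro r hr
        have : (r : ℝ) < m := by exact_mod_cast (Finset.mem_range.1 hr).trans_le hm
        have := sub_pos.2 this
        positivity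

theorem sum_one_div_nonneg {k m : ℕ} (hm : k ≤ m) {μ : ℝ} (hμ : 0 < μ) :
    0 ≤ ∑ r ∈ Finset.range k, 1 / (μ * (m - r : ℝ)) := by
  refine Finset.sum_nonneg fun r hr => ?_
  have : (r : ℝ) < m := by exact_mod_cast (Finset.mem_range.1 hr).trans_le hm
  have := sub_pos.2 this
  positivity

theorem orderStat_expMeasure_nonneg {k m : ℕ} (hk : 1 ≤ k) (hm : k ≤ m) {μ : ℝ} (hμ : 0 < μ) :
    ∀ᵐ x ∂(Measure.pi fun _ : Fin m => expMeasure μ), 0 ≤ orderStat k x := by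
  have := isProbabilityMeasure_expMeasure hμ
  filter_upwards [ae_pi_nonneg (expMeasure_nonneg hμ)] with x hx using le_orderStat hk hm x 0 hx

theorem integrable_orderStat_expMeasure {k m : ℕ} (hk : 1 ≤ k) (hm : k ≤ m) {μ : ℝ}
    (hμ : 0 < μ) :
    Integrable (fun x : Fin m → ℝ => orderStat k x) (Measure.pi fun _ => expMeasure μ) := by
  refine ⟨(measurable_orderStat hk hm).aestronglyMeasurable, ?_⟩
  rw [hasFiniteIntegral_iff_ofReal (orderStat_expMeasure_nonneg hk hm hμ),
    lintegral_orderStat_expMeasure hk hm hμ]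
  exact ENNReal.ofReal_lt_top

theorem meanOrderStat_expMeasure {k m : ℕ} (hk : 1 ≤ k) (hm : k ≤ m) {μ : ℝ} (hμ : 0 < μ) :
    meanOrderStat (expMeasure μ) k m = ∑ r ∈ Finset.range k, 1 / (μ * (m - r : ℝ)) := by
  rw [meanOrderStat, integral_eq_lintegral_of_nonneg_ae (orderStat_expMeasure_nonneg hk hm hμ)
    (measurable_orderStat hk hm).aestronglyMeasurable, lintegral_orderStat_expMeasure hk hm hμ,
    ENNReal.toReal_ofReal (sum_one_div_nonneg hm hμ)]

theorem sum_meanOrderStat_expMeasure {n K P : ℕ} (hK : 1 ≤ K) (hP : P = n * K) {μ : ℝ}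
    (hμ : 0 < μ) :
    ∑ i ∈ Finset.range n, meanOrderStat (expMeasure μ) K (P - i * K) = (harmonic P : ℝ) / μ := by
  subst hP
  induction n with
  | zero => simp
  | succ n ih =>
    -- Peel off `i = 0`, the block of the `K` largest denominators; the rest is the sum for `n * K`
    -- workers.
    rw [Finset.sum_range_succ']
    have h1 : ∀ i, (n + 1) * K - (i + 1) * K = n * K - i * K := by
      intro i
      rw [add_mul, add_mul]
      omega
    simp_rw [h1, ih]
    rw [zero_mul, Nat.sub_zero, meanOrderStat_expMeasure hK (Nat.le_mul_of_pos_left K n.succ_pos) hμ]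
    rw [show (n + 1) * K = n * K + K by ring]
    generalize n * K = N
    have h2 : ((harmonic (N + K) : ℚ) : ℝ)
        = harmonic N + ∑ r ∈ Finset.range K, 1 / ((N + K : ℝ) - r) := by
      clear hK h1 ih
      induction K with
      | zero => simp
      | succ K ih =>
        rw [← add_assoc, harmonic_succ, Finset.sum_range_succ']
        push_cast
        rw [ih]
        have : ∀ r : ℕ, (N + (K + 1) : ℝ) - (r + 1) = N + K - r := fun r => by ring
        simp_rw [this]
        ring_nf
    rw [h2, add_div, Finset.sum_div]
    push_cast
    congr 1
    refine Finset.sum_congr rfl fun r _ => ?_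
    rw [div_div, mul_comm]

theorem lintegral_max_shiftedExp_le {m : ℕ} (hm : 1 ≤ m) {Δ μ : ℝ} (hΔ : 0 ≤ Δ) (hμ : 0 < μ) :
    ∫⁻ w, ENNReal.ofReal (orderStat m w) ∂(Measure.pi fun _ : Fin m => shiftedExp Δ μ)
      ≤ ENNReal.ofReal (Δ + harmonic m / μ) := by
  have := isProbabilityMeasure_expMeasure hμ
  have := isProbabilityMeasure_shiftedExp Δ hμ
  have hos : ∀ x : Fin m → ℝ, orderStat m (fun i => Δ + x i) = Δ + orderStat m x := by
    intro x
    refine eq_of_forall_ge_iff fun s => ?_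
    simp only [orderStat_self_le_iff hm, ← le_sub_iff_add_le']
  -- One block of size `m`: the mean maximum is `harmonic m / μ`.
  have hH := sum_meanOrderStat_expMeasure hm (one_mul m).symm hμ
  simp only [Finset.range_one, Finset.sum_singleton, zero_mul, Nat.sub_zero] at hH
  have hadd : Measurable fun x : ℝ => Δ + x := measurable_const_add Δ
  have hpi : (Measure.pi fun _ : Fin m => shiftedExp Δ μ)
      = (Measure.pi fun _ : Fin m => expMeasure μ).map fun x i => Δ + x i :=
    have : ∀ _ : Fin m, SigmaFinite ((expMeasure μ).map fun x => Δ + x) := fun _ =>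
      inferInstanceAs (SigmaFinite (shiftedExp Δ μ))
    (Measure.pi_map_pi fun _ => hadd.aemeasurable).symm
  have hshift : Measurable fun (x : Fin m → ℝ) i => Δ + x i :=
    measurable_pi_lambda _ fun i => hadd.comp (measurable_pi_apply i)
  rw [hpi, lintegral_map (measurable_orderStat hm le_rfl).ennreal_ofReal hshift, ← hH,
    meanOrderStat_expMeasure hm le_rfl hμ, ENNReal.ofReal_add hΔ (sum_one_div_nonneg le_rfl hμ),
    ← lintegral_orderStat_expMeasure hm le_rfl hμ]
  simp_rw [hos]
  refine (lintegral_mono fun x => ENNReal.ofReal_add_le).trans ?_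
  rw [lintegral_add_left measurable_const, lintegral_const, measure_univ, mul_one]

theorem abs_harmonic_sub_log_le {P : ℕ} (hP : 1 ≤ P) : |(harmonic P : ℝ) - Real.log P| ≤ 1 := by
  have h1 := log_add_one_le_harmonic P
  have h2 := harmonic_le_one_add_log P
  have hP' : (0 : ℝ) < P := by exact_mod_cast hP
  have h3 : Real.log P ≤ Real.log ((P + 1 : ℕ) : ℝ) := Real.log_le_log hP' (by simp)
  rw [abs_le]
  constructor <;> linarith

/-! ### Expected runtimes and conclusion -/

namespace KAsync

theorem time_add_sub_le_maxResidual {n K P : ℕ} (hn : 1 ≤ n) (hK : 1 ≤ K) (hP : P = n * K)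
    (X : Fin P → ℕ → ℝ) (j : ℕ) :
    (state K X (j + n)).time - (state K X j).time ≤ maxResidual K X j := by
  have hP1 : 1 ≤ P := hP ▸ Nat.mul_pos hn hK
  have h := (orderStat_self_le_iff hP1 _ _).1
    (le_refl (orderStat P fun i => (state K X j).finish X i - (state K X j).time))
  rw [sub_le_iff_le_add]
  exact time_add_le X hn hK hP j _ fun i => sub_le_iff_le_add.1 (h i)

theorem sum_runtime {K P : ℕ} (X : Fin P → ℕ → ℝ) (j n : ℕ) :
    ∑ l ∈ Finset.range n, runtime K X (j + l)
      = (state K X (j + n)).time - (state K X j).time :=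
  Finset.sum_range_sub (fun l => (state K X (j + l)).time) n

variable {Ω : Type*} [MeasurableSpace Ω] {Pr : Measure Ω}

theorem integrable_and_integral_sum_runtime_le {n K P : ℕ} (hn : 1 ≤ n) (hK : 1 ≤ K)
    (hP : P = n * K) {X : Fin P → ℕ → Ω → ℝ} (hX : ∀ i k, Measurable (X i k))
    (hX0 : ∀ i k ω, 0 ≤ X i k ω) (j : ℕ) {C : ℝ} (hC : 0 ≤ C)
    (h : ∫⁻ ω, ENNReal.ofReal (maxResidual K (fun i k => X i k ω) j) ∂Pr ≤ ENNReal.ofReal C) :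
    Integrable (fun ω => runtime K (fun i k => X i k ω) j) Pr ∧
    ∫ ω, ∑ l ∈ Finset.range n, runtime K (fun i k => X i k ω) (j + l) ∂Pr ≤ C := by
  have hKP : K ≤ P := hP ▸ Nat.le_mul_of_pos_left K hn
  have htm : ∀ j, Measurable fun ω => (state K (fun i k => X i k ω) j).time := fun j =>
    (measurable_state hK hKP hX j).1
  have hmono : ∀ ω, Monotone fun j => (state K (fun i k => X i k ω) j).time := fun ω =>
    time_mono _ hK hKP fun i k => hX0 i k ω
  constructor
  · refine ⟨((htm (j + 1)).sub (htm j)).aestronglyMeasurable, ?_⟩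
    have hnn : ∀ ω, 0 ≤ runtime K (fun i k => X i k ω) j := fun ω =>
      sub_nonneg.2 (hmono ω j.le_succ)
    rw [hasFiniteIntegral_iff_ofReal (Filter.Eventually.of_forall hnn)]
    refine ((lintegral_mono fun ω => ENNReal.ofReal_le_ofReal ?_).trans h).trans_lt
      ENNReal.ofReal_lt_top
    exact (sub_le_sub_right (hmono ω (show j + 1 ≤ j + n by omega)) _).trans
      (time_add_sub_le_maxResidual hn hK hP _ j)
  · simp_rw [sum_runtime]
    rw [integral_eq_lintegral_of_nonneg_ae
      (Filter.Eventually.of_forall fun ω => sub_nonneg.2 (hmono ω (Nat.le_add_right j n)))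
      ((htm (j + n)).sub (htm j)).aestronglyMeasurable]
    refine ENNReal.toReal_le_of_le_ofReal hC (le_trans ?_ h)
    exact lintegral_mono fun ω =>
      ENNReal.ofReal_le_ofReal (time_add_sub_le_maxResidual hn hK hP _ j)

/-- `HasLaw` gives only a.e. measurability and a.e. nonnegativity, whereas the pathwise lemmas need
both everywhere; absolute values of measurable modifications provide this. -/
theorem exists_measurable_nonneg_version {ι : Type*} [Countable ι] {ν : Measure ℝ}
    (h0 : ∀ᵐ x ∂ν, 0 ≤ x) {X : ι → ℕ → Ω → ℝ} (hlaw : ∀ i k, HasLaw (X i k) ν Pr)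
    (hindep : iIndepFun (fun p : ι × ℕ => X p.1 p.2) Pr) :
    ∃ X' : ι → ℕ → Ω → ℝ, (∀ i k, Measurable (X' i k)) ∧ (∀ i k ω, 0 ≤ X' i k ω) ∧
      (∀ i k, Pr.map (X' i k) = ν) ∧ iIndepFun (fun p : ι × ℕ => X' p.1 p.2) Pr ∧
      ∀ᵐ ω ∂Pr, (fun i k => X i k ω) = fun i k => X' i k ω := by
  let X' : ι → ℕ → Ω → ℝ := fun i k ω => |(hlaw i k).aemeasurable.mk (X i k) ω|
  have hXX' : ∀ i k, X i k =ᵐ[Pr] X' i k := by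
    intro i k
    have h0' : ∀ᵐ ω ∂Pr, 0 ≤ X i k ω := by
      have h0' := h0
      rw [← (hlaw i k).map_eq] at h0'
      exact ae_of_ae_map (hlaw i k).aemeasurable h0'
    filter_upwards [h0', (hlaw i k).aemeasurable.ae_eq_mk] with ω h1 h2
    simp only [X']
    rw [← h2, abs_of_nonneg h1]
  refine ⟨X', fun i k => (hlaw i k).aemeasurable.measurable_mk.abs, fun i k ω => abs_nonneg _,
    fun i k => ?_, hindep.congr fun p => hXX' p.1 p.2, ?_⟩
  · rw [← Measure.map_congr (hXX' i k), (hlaw i k).map_eq]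
  · filter_upwards [ae_all_iff.2 fun i => ae_all_iff.2 fun k => hXX' i k] with ω h
    funext i k
    exact h i k

theorem integrable_and_integral_sum_runtime_le_of_shiftedExp [IsProbabilityMeasure Pr]
    {n K P : ℕ} (hn : 1 ≤ n) (hK : 1 ≤ K) (hP : P = n * K) {Δ μ : ℝ} (hΔ : 0 ≤ Δ)
    (hμ : 0 < μ) {X : Fin P → ℕ → Ω → ℝ} (hlaw : ∀ i k, HasLaw (X i k) (shiftedExp Δ μ) Pr)
    (hindep : iIndepFun (fun p : Fin P × ℕ => X p.1 p.2) Pr) (j : ℕ) :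
    Integrable (fun ω => runtime K (fun i k => X i k ω) j) Pr ∧
    ∫ ω, ∑ l ∈ Finset.range n, runtime K (fun i k => X i k ω) (j + l) ∂Pr
      ≤ Δ + harmonic P / μ := by
  have := isProbabilityMeasure_shiftedExp Δ hμ
  have hKP : K ≤ P := hP ▸ Nat.le_mul_of_pos_left K hn
  have hP1 : 1 ≤ P := hK.trans hKP
  obtain ⟨X', hX'm, hX'0, hlaw', hindep', hae⟩ :=
    exists_measurable_nonneg_version (shiftedExp_nonneg hΔ hμ) hlaw hindep
  have hH : (0 : ℝ) ≤ harmonic P := by exact_mod_cast (harmonic_pos (by omega)).le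
  have hmain := (lintegral_maxResidual_le hK hKP (shiftedExp_nonneg hΔ hμ)
    (shiftedExp_Ici_mul_Iic_le hΔ hμ) hX'm hX'0 hlaw' hindep' j).trans
    (lintegral_max_shiftedExp_le hP1 hΔ hμ)
  obtain ⟨h1, h2⟩ := integrable_and_integral_sum_runtime_le hn hK hP hX'm hX'0 j
    (add_nonneg hΔ (div_nonneg hH hμ.le)) hmain
  constructor
  · refine h1.congr ?_
    filter_upwards [hae] with ω h
    rw [h]
  · refine le_trans (le_of_eq (integral_congr_ae ?_)) h2
    filter_upwards [hae] with ω h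
    rw [h]

end KAsync

theorem mainTheorem9 {Ω : Type*} [MeasurableSpace Ω] (Pr : Measure Ω) [IsProbabilityMeasure Pr]
    (n K P : ℕ) (hn : 1 < n) (hK : 1 ≤ K) (hP : P = n * K)
    (Δ μ : ℝ) (hΔ : 0 ≤ Δ) (hμ : 0 < μ)
    -- `X i k` is the time that worker `i` needs for its `k`-th mini-batch
    (X : Fin P → ℕ → Ω → ℝ)
    (hlaw : ∀ i k, HasLaw (X i k) (shiftedExp Δ μ) Pr)
    (hindep : iIndepFun (fun p : Fin P × ℕ => X p.1 p.2) Pr) :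
    -- all the expectations below exist
    (∀ j, Integrable (fun ω => KAsync.runtime K (fun i k => X i k ω) j) Pr) ∧
    (∀ i < n, Integrable (fun x : Fin (P - i * K) → ℝ => orderStat K x)
      (Measure.pi fun _ => expMeasure μ)) ∧
    -- the bound for any `n` consecutive iterations `j, …, j + n - 1`
    (∀ j, ∫ ω, ∑ l ∈ Finset.range n, KAsync.runtime K (fun i k => X i k ω) (j + l) ∂Pr
      ≤ Δ + ∑ i ∈ Finset.range n, meanOrderStat (expMeasure μ) K (P - i * K)) ∧
    -- the size of the resulting bound per iteration
    |(1 / (n : ℝ)) * (Δ + ∑ i ∈ Finset.range n, meanOrderStat (expMeasure μ) K (P - i * K))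
      - ((K : ℝ) * Δ / P + (K : ℝ) * Real.log P / (P * μ))| ≤ (K : ℝ) / (P * μ) ∧
    -- the bound on the expected runtime per iteration
    (∀ j, (1 / (n : ℝ)) *
        ∫ ω, ∑ l ∈ Finset.range n, KAsync.runtime K (fun i k => X i k ω) (j + l) ∂Pr
      ≤ (K : ℝ) * Δ / P + (K : ℝ) * (Real.log P + 1) / (P * μ)) := by
  have hn0 : (0 : ℝ) < n := by exact_mod_cast (by omega : 0 < n)
  have hK0 : (0 : ℝ) < K := by exact_mod_cast hK
  have hPnK : (P : ℝ) = n * K := by exact_mod_cast hP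
  have hP1 : 1 ≤ P := hP ▸ Nat.mul_pos (by omega) hK
  have hP0 : (0 : ℝ) < P := by exact_mod_cast hP1
  have hmain := KAsync.integrable_and_integral_sum_runtime_le_of_shiftedExp hn.le hK hP hΔ hμ hlaw hindep
  have habs := abs_harmonic_sub_log_le hP1
  -- As `1 / n = K / P`, the whole error comes from replacing `harmonic P` by `log P`.
  have hdiff : 1 / (n : ℝ) * (Δ + harmonic P / μ)
      - ((K : ℝ) * Δ / P + (K : ℝ) * Real.log P / (P * μ))
      = K / (P * μ) * (harmonic P - Real.log P) := by
    rw [hPnK]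
    field_simp
    ring
  have hpos : 0 ≤ (K : ℝ) / (P * μ) := by positivity
  rw [sum_meanOrderStat_expMeasure hK hP hμ]
  refine ⟨fun j => (hmain j).1, fun i hi => ?_, fun j => (hmain j).2, ?_, fun j => ?_⟩
  · refine integrable_orderStat_expMeasure hK ?_ hμ
    have : (i + 1) * K ≤ n * K := Nat.mul_le_mul_right K hi
    rw [add_mul, one_mul] at this
    omega
  · rw [hdiff, abs_mul, abs_of_nonneg hpos]
    exact mul_le_of_le_one_right hpos habs
  · have h1 := mul_le_mul_of_nonneg_left (hmain j).2 (one_div_pos.2 hn0).le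
    have h2 := mul_le_mul_of_nonneg_left (abs_le.1 habs).2 hpos
    have h3 : (K : ℝ) * (Real.log P + 1) / (P * μ)
        = K * Real.log P / (P * μ) + K / (P * μ) * 1 := by ring
    rw [h3]
    linarith
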